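/- Let $S=K[x_1,\dots,x_n]$ be a polynomial ring over a field $K$. A clutter $\mathcal C$ on $[n]=\{1,\dots,n\}$ is a family of subsets of $[n]$, called edges, none of which is contained in another; its edge ideal is $I(\mathcal C)=(x_C : C\in\mathcal C)\subseteq S$, where $x_C=\prod_{i\in C}x_i$, and $\Delta_{\mathcal C}$ denotes the simplicial complex on $[n]$ whose Stanley–Reisner ideal is $I(\mathcal C)$, i.e. the complex of all $F\subseteq[n]$ that contain no edge of $\mathcal C$. (Here a simplicial complex on $[n]$ is a family of subsets of $[n]$ closed under taking subsets; not every $i\in[n]$ need be a vertex, and the family may be empty.) For a monomial ideal $I$ with minimal set of monomial generators $G(I)$, a variable is called free if it divides exactly one element of $G(I)$. For disjoint sets of variables $X_1,X_2$, let $I_{(X_1,X_2)}$ be the ideal, in the polynomial ring over $K$ in the variables outside $X_1\cup X_2$, obtained from $I$ by setting the variables in $X_1$ equal to $0$ and those in $X_2$ equal to $1$; the minors of $I$ are the ideals of this form that are neither zero nor the whole ring. The clutter $\mathcal C$ has the free vertex property if every minor of $I(\mathcal C)$ has a free variable. The ring $S/I$ is clean if there is a chain of ideals $I=I_0\subset I_1\subset\cdots\subset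 I_r=S$ such that for each $j=1,\dots,r$ one has $I_j/I_{j-1}\cong S/P_j$ as $S$-modules, where $P_j$ is a monomial prime ideal (an ideal generated by variables) that is a minimal prime ideal of $I$. A simplicial complex is (non-pure) shellable if its facets can be ordered $F_1,\dots,F_m$, without repetition, such that for every $k=2,\dots,m$ the complex $\langle F_k\rangle\cap\langle F_1,\dots,F_{k-1}\rangle$ is pure of dimension $\dim F_k-1$. **Corollary.** If a clutter $\mathcal C$ on $[n]$ has the free vertex property, then $S/I(\mathcal C)$ is clean, and $\Delta_{\mathcal C}$ is shellable. -/

import Mathlib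

/-! ### Monomial ideals: minimal generators, free variables, minors -/

/-- `G(I)`: the exponent vectors of the minimal monomial generators of a monomial ideal `I`, i.e. of
the monomials in `I` that are minimal with respect to divisibility. -/
def minimalMonomialGenerators {σ K : Type*} [Field K] (I : Ideal (MvPolynomial σ K)) :
    Set (σ →₀ ℕ) :=
  {u | Minimal (fun v => MvPolynomial.monomial v (1 : K) ∈ I) u}

/-- The variable `x_i` is a free variable of `I`: it divides exactly one element of `G(I)`. -/
def IsFreeVariable {σ K : Type*} [Field K] (I : Ideal (MvPolynomial σ K)) (i : σ) : Prop :=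
  ∃ u ∈ minimalMonomialGenerators I, u i ≠ 0 ∧
    ∀ v ∈ minimalMonomialGenerators I, v ≠ u → v i = 0

open Classical in
/-- The substitution `x_i ↦ 0` for `i ∈ X₁`, `x_i ↦ 1` for `i ∈ X₂`, with values in the polynomial
ring in the remaining variables. -/
noncomputable def minorMap {σ : Type*} (K : Type*) [Field K] (X₁ X₂ : Set σ) :
    MvPolynomial σ K →ₐ[K] MvPolynomial {i : σ // i ∉ X₁ ∧ i ∉ X₂} K :=
  MvPolynomial.aeval fun i =>
    if h₁ : i ∈ X₁ then 0
    else if h₂ : i ∈ X₂ then 1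
    else MvPolynomial.X ⟨i, h₁, h₂⟩

/-- The minor of `I` with respect to `(X₁, X₂)`: the ideal of the polynomial ring in the remaining
variables obtained by setting the variables in `X₁` to `0` and those in `X₂` to `1`. -/
noncomputable def Ideal.minor {σ K : Type*} [Field K] (I : Ideal (MvPolynomial σ K))
    (X₁ X₂ : Set σ) : Ideal (MvPolynomial {i : σ // i ∉ X₁ ∧ i ∉ X₂} K) :=
  I.map (minorMap K X₁ X₂)

/-- The free variable property: every minor of `I` has a free variable. As usual, only the nonzero
proper ideals among the `I.minor X₁ X₂` count: the zero ideal and the unit ideal involve no variable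
at all, and setting all variables to `0` always produces one of these two. -/
def HasFreeVariableProperty {σ K : Type*} [Field K] (I : Ideal (MvPolynomial σ K)) : Prop :=
  ∀ X₁ X₂ : Set σ, Disjoint X₁ X₂ → I.minor X₁ X₂ ≠ ⊥ → I.minor X₁ X₂ ≠ ⊤ →
    ∃ i, IsFreeVariable (I.minor X₁ X₂) i

/-! ### Clean ideals -/

/-- A monomial prime ideal: an ideal generated by a set of variables. -/
def IsMonomialPrime {σ K : Type*} [Field K] (P : Ideal (MvPolynomial σ K)) : Prop :=
  ∃ A : Set σ, P = Ideal.span (MvPolynomial.X '' A)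

/-- `S/I` is clean: there is a chain of ideals `I = J₀ ⊆ J₁ ⊆ ⋯ ⊆ J_r = S` such that each quotient
`J_{j+1}/J_j` is isomorphic, as an `S`-module, to `S/P_j` for a monomial prime ideal `P_j` which is
a minimal prime ideal of `I`. -/
def IsClean {σ K : Type*} [Field K] (I : Ideal (MvPolynomial σ K)) : Prop :=
  ∃ (r : ℕ) (J : Fin (r + 1) → Ideal (MvPolynomial σ K)) (P : Fin r → Ideal (MvPolynomial σ K)),
    J 0 = I ∧ J (Fin.last r) = ⊤ ∧
    ∀ j : Fin r, J j.castSucc ≤ J j.succ ∧ IsMonomialPrime (P j) ∧ P j ∈ I.minimalPrimes ∧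
      Nonempty ((↥(J j.succ) ⧸ (J j.castSucc).submoduleOf (J j.succ))
        ≃ₗ[MvPolynomial σ K] (MvPolynomial σ K ⧸ P j))

/-! ### Simplicial complexes -/

/-- A simplicial complex with vertices in `V`, given by its faces (including the empty one). Not
every element of `V` need be a vertex, and the void complex, without any face, is allowed: these
occur as Stanley–Reisner complexes. (Mathlib's `PreAbstractSimplicialComplex` drops the empty face
and so does not distinguish `{∅}` from the void complex.) -/
abbrev FaceComplex (V : Type*) := LowerSet (Finset V)

/-- The facets: the maximal faces. -/
def FaceComplex.facets {V : Type*} (Δ : FaceComplex V) : Set (Finset V) :=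
  {F | Maximal (fun G => G ∈ Δ) F}

/-- (Nonpure) shellability in the sense of Björner and Wachs: the facets can be listed without
repetition as `F₁, …, F_m` so that for every `k ≥ 2` the complex
`⟨F_k⟩ ∩ (⟨F₁⟩ ∪ ⋯ ∪ ⟨F_{k-1}⟩)` is pure of dimension `dim F_k - 1`, i.e. all its maximal faces have
`|F_k| - 1` elements. (For the first facet this complex is void and the condition is empty.) -/
def FaceComplex.IsShellable {V : Type*} (Δ : FaceComplex V) : Prop :=
  ∃ (m : ℕ) (F : Fin m → Finset V), Function.Injective F ∧ Set.range F = Δ.facets ∧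
    ∀ (k : Fin m) (G : Finset V),
      Maximal (fun H => H ⊆ F k ∧ ∃ i, i < k ∧ H ⊆ F i) G → G.card + 1 = (F k).card

/-- The Stanley–Reisner ideal, generated by the monomials `x_F` with `F` not a face. -/
noncomputable def FaceComplex.stanleyReisnerIdeal {V : Type*} (K : Type*) [Field K]
    (Δ : FaceComplex V) : Ideal (MvPolynomial V K) :=
  Ideal.span ((fun F : Finset V => ∏ i ∈ F, (MvPolynomial.X i : MvPolynomial V K)) ''
    {F | F ∉ Δ})

/-! ### Clutters -/

/-- A clutter with vertex set `V`: a family of subsets of `V`, none contained in another. -/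
structure Clutter (V : Type*) where
  /-- the edges of the clutter -/
  edges : Set (Finset V)
  isAntichain : IsAntichain (· ⊆ ·) edges

/-- The edge ideal `I(𝒞)`, generated by the monomials `x_C` with `C` an edge. -/
noncomputable def Clutter.edgeIdeal {V : Type*} (K : Type*) [Field K] (C : Clutter V) :
    Ideal (MvPolynomial V K) :=
  Ideal.span ((fun e : Finset V => ∏ i ∈ e, (MvPolynomial.X i : MvPolynomial V K)) '' C.edges)

/-- A clutter has the free vertex property (over `K`) if its edge ideal has the free variable
property. -/
def Clutter.HasFreeVertexProperty {V : Type*} (K : Type*) [Field K] (C : Clutter V) : Prop :=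
  HasFreeVariableProperty (C.edgeIdeal K)

/-- `Δ_𝒞`: the faces are the sets which contain no edge. By the two lemmas below this is the unique
simplicial complex whose Stanley–Reisner ideal is the edge ideal of `𝒞`. -/
def Clutter.stanleyReisnerComplex {V : Type*} (C : Clutter V) : FaceComplex V where
  carrier := {F | ∀ e ∈ C.edges, ¬ e ⊆ F}
  lower' := fun _ _ hGF hF e he heG => hF e he (heG.trans hGF)

theorem Clutter.stanleyReisnerIdeal_stanleyReisnerComplex {V : Type*} (K : Type*) [Field K]
    (C : Clutter V) : C.stanleyReisnerComplex.stanleyReisnerIdeal K = C.edgeIdeal K := by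
  apply le_antisymm
  · refine Ideal.span_le.2 ?_
    rintro _ ⟨F, hF, rfl⟩
    have hF' : ¬ ∀ e ∈ C.edges, ¬ e ⊆ F := hF
    push Not at hF'
    obtain ⟨e, he, heF⟩ := hF'
    exact Ideal.mem_of_dvd _ (Finset.prod_dvd_prod_of_subset e F _ heF)
      (Ideal.subset_span ⟨e, he, rfl⟩)
  · refine Ideal.span_mono (Set.image_mono ?_)
    intro e he h
    exact h e he subset_rfl

theorem FaceComplex.prod_X_mem_stanleyReisnerIdeal {V : Type*} (K : Type*) [Field K]
    (Δ : FaceComplex V) (F : Finset V) :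
    (∏ i ∈ F, (MvPolynomial.X i : MvPolynomial V K)) ∈ Δ.stanleyReisnerIdeal K ↔ F ∉ Δ := by
  classical
  refine ⟨fun h hF => ?_, fun h => Ideal.subset_span ⟨F, h, rfl⟩⟩
  let φ : MvPolynomial V K →ₐ[K] K := MvPolynomial.aeval fun i => if i ∈ F then 1 else 0
  have hle : Δ.stanleyReisnerIdeal K ≤ RingHom.ker φ := by
    refine Ideal.span_le.2 ?_
    rintro _ ⟨G, hG, rfl⟩
    have hGF : ¬ G ⊆ F := fun hGF => hG (Δ.lower hGF hF)
    obtain ⟨i, hiG, hiF⟩ := Finset.not_subset.1 hGF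
    simp only [SetLike.mem_coe, RingHom.mem_ker, map_prod]
    exact Finset.prod_eq_zero hiG (by simp [φ, hiF])
  have h0 : φ (∏ i ∈ F, MvPolynomial.X i) = 0 := hle h
  have h1 : φ (∏ i ∈ F, MvPolynomial.X i) = 1 := by
    rw [map_prod]
    exact Finset.prod_eq_one fun i hi => by simp [φ, hi]
  exact one_ne_zero (h1.symm.trans h0)

theorem FaceComplex.stanleyReisnerIdeal_injective {V : Type*} (K : Type*) [Field K] :
    Function.Injective (FaceComplex.stanleyReisnerIdeal (V := V) K) := by
  intro Δ Γ h
  ext F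
  have h1 := FaceComplex.prod_X_mem_stanleyReisnerIdeal K Δ F
  rw [h, FaceComplex.prod_X_mem_stanleyReisnerIdeal K Γ F] at h1
  exact (not_iff_not.1 h1).symm

/-!
Let `Δ` be the complex of `𝒞` and `I` its Stanley–Reisner ideal, which is the edge ideal. It suffices
to shell `Δ`: by Dress's theorem (`FaceComplex.IsShellable.isClean`) the Stanley–Reisner ring of a
shellable complex is clean. For a shelling `F₁, …, F_m`, the ideals of the complexes
`⟨F₁, …, F_k⟩`, taken with `k` decreasing from `m` to `0`, form the required chain. Each step adjoins
the single monomial `x_R` of the restriction set `R` of `F_k`, and the colon ideal by `x_R` is the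
minimal prime generated by the variables outside `F_k`.

A free variable `x`, dividing only the generator `x · ∏ i ∈ u, X i`, makes `insert x u` a nonface
and the only obstruction to adding `x` to a face. Hence each facet contains exactly one of `{x}` and
`u`, so the facets of `Δ` are those of the star of `x` together with those of the star of `u`, and
these two stars are again minors: contract `x`, or delete `x` and contract `u`. Concatenating
shellings of the two stars gives one of `Δ` (`FaceComplex.isShellable_of_star`): if a facet `F`
contains `u` and `v ∈ u`, then `x` can be added to `F \ {v}`, so each ridge `F \ {v}` lies in a
facet of the star of `x`, while no facet there contains all of `u`. Induction on the number of
vertices that are neither deleted nor contracted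
(`FaceComplex.HasFreeMinors.isShellable_minor`) ends with void complexes and simplices. To avoid
changing the ground set, minors of complexes are kept on the original vertex set;
`FaceComplex.monomial_mem_minor_iff` compares them with minors of ideals.
-/

/-! ### Shellings in exchange form -/

namespace FaceComplex

variable {V : Type*}

theorem exists_facet_of_mem [Finite V] {Δ : FaceComplex V} {F : Finset V} (hF : F ∈ Δ) :
    ∃ G ∈ Δ.facets, F ⊆ G := by
  obtain ⟨G, hFG, hG⟩ := Finite.exists_le_maximal (p := fun G => G ∈ Δ) hF
  exact ⟨G, hG, hFG⟩

/-- The exchange form of the shelling condition: if `i < k`, some ridge `F k \ {v}` of `F k` contains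
`F i ∩ F k` and lies in an earlier facet. -/
def IsShellingOrder [DecidableEq V] {m : ℕ} (F : Fin m → Finset V) : Prop :=
  ∀ k, ∀ i < k, ∃ v ∈ F k, v ∉ F i ∧ ∃ j < k, (F k).erase v ⊆ F j

theorem isShellable_iff [Finite V] [DecidableEq V] (Δ : FaceComplex V) :
    Δ.IsShellable ↔ ∃ (m : ℕ) (F : Fin m → Finset V), Function.Injective F ∧
      Set.range F = Δ.facets ∧ IsShellingOrder F := by
  refine exists_congr fun m => exists_congr fun F => and_congr_right fun hinj =>
    and_congr_right fun hF => ⟨fun h k i hik => ?_, fun h k G hG => ?_⟩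
  · obtain ⟨G, hle, hG⟩ := Finite.exists_le_maximal
      (p := fun H => H ⊆ F k ∧ ∃ i, i < k ∧ H ⊆ F i) (a := F i ∩ F k)
      ⟨Finset.inter_subset_right, i, hik, Finset.inter_subset_left⟩
    have hc := h k G hG
    obtain ⟨hGk, j, hj, hGj⟩ := hG.prop
    obtain ⟨v, hv, rfl⟩ : ∃ v ∈ F k, (F k).erase v = G := by
      have h1 : (F k \ G).card = 1 := by
        rw [Finset.card_sdiff_of_subset hGk]; omega
      obtain ⟨v, hv⟩ := Finset.card_eq_one.1 h1
      refine ⟨v, (Finset.mem_sdiff.1 (hv ▸ Finset.mem_singleton_self v)).1, ?_⟩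
      rw [← Finset.sdiff_singleton_eq_erase, ← hv, Finset.sdiff_sdiff_eq_self hGk]
    refine ⟨v, hv, fun hvi => ?_, j, hj, hGj⟩
    exact Finset.notMem_erase v (F k) (hle (Finset.mem_inter.2 ⟨hvi, hv⟩))
  · obtain ⟨hGk, i, hi, hGi⟩ := hG.prop
    obtain ⟨v, hv, hvi, j, hj, hvj⟩ := h k i hi
    have hGv : G ⊆ (F k).erase v := fun w hw =>
      Finset.mem_erase.2 ⟨fun hwv => hvi (hwv ▸ hGi hw), hGk hw⟩
    rw [hG.eq_of_le ⟨Finset.erase_subset _ _, j, hj, hvj⟩ hGv]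
    exact Finset.card_erase_add_one hv

/-! ### Shelling a complex split into two stars -/

/-- The closed star of `s` in `Δ`. Its Stanley–Reisner ideal is the colon ideal of that of `Δ` by
`∏ i ∈ s, X i`; it is void if `s` is not a face. -/
def star [DecidableEq V] (Δ : FaceComplex V) (s : Finset V) : FaceComplex V where
  carrier := {F | F ∪ s ∈ Δ}
  lower' := fun _ _ h hF => Δ.lower (Finset.union_subset_union_left h) hF

theorem mem_star [DecidableEq V] {Δ : FaceComplex V} {s F : Finset V} :
    F ∈ Δ.star s ↔ F ∪ s ∈ Δ := Iff.rfl

theorem mem_facets_star [DecidableEq V] {Δ : FaceComplex V} {s F : Finset V} :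
    F ∈ (Δ.star s).facets ↔ F ∈ Δ.facets ∧ s ⊆ F := by
  constructor
  · intro hF
    have hs : s ⊆ F := by
      have h : F ∪ s ∈ Δ.star s := by
        rw [mem_star, Finset.union_assoc, Finset.union_self]; exact hF.prop
      rw [hF.eq_of_le h Finset.subset_union_left]
      exact Finset.subset_union_right
    have hFΔ : F ∈ Δ := Δ.lower Finset.subset_union_left hF.prop
    refine ⟨⟨hFΔ, fun G hG hFG => hF.le_of_ge ?_ hFG⟩, hs⟩
    rw [mem_star, Finset.union_eq_left.2 (hs.trans hFG)]
    exact hG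
  · rintro ⟨hF, hs⟩
    refine ⟨?_, fun G hG hFG => hF.le_of_ge (Δ.lower Finset.subset_union_left hG) hFG⟩
    change F ∪ s ∈ Δ
    rw [Finset.union_eq_left.2 hs]
    exact hF.prop

/-- If the only obstruction to adding `x` to a face is that the face contains `u`, the facets of `Δ`
are those of the star of `x` together with those of the star of `u`, and shellings of the two stars,
in this order, form a shelling of `Δ`. -/
theorem isShellable_of_star [Finite V] [DecidableEq V] {Δ : FaceComplex V} {x : V} {u : Finset V}
    (hxu : insert x u ∉ Δ) (hadd : ∀ F ∈ Δ, ¬ u ⊆ F → insert x F ∈ Δ)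
    (hx : (Δ.star {x}).IsShellable) (hu : (Δ.star u).IsShellable) : Δ.IsShellable := by
  rw [isShellable_iff] at *
  obtain ⟨a, A, hAinj, hA, hAs⟩ := hx
  obtain ⟨b, B, hBinj, hB, hBs⟩ := hu
  have hA' : ∀ i, A i ∈ Δ.facets ∧ x ∈ A i := fun i => by
    have := mem_facets_star.1 (hA ▸ Set.mem_range_self i)
    simpa using this
  have hB' : ∀ i, B i ∈ Δ.facets ∧ u ⊆ B i := fun i =>
    mem_facets_star.1 (hB ▸ Set.mem_range_self i)
  have hAu : ∀ i, ¬ u ⊆ A i := fun i h =>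
    hxu (Δ.lower (Finset.insert_subset (hA' i).2 h) (hA' i).1.prop)
  refine ⟨a + b, Fin.append A B, Fin.append_injective_iff.2
    ⟨hAinj, hBinj, fun i j h => hAu i (h ▸ (hB' j).2)⟩, ?_, ?_⟩
  · ext F
    constructor
    · rintro ⟨i, rfl⟩
      induction i using Fin.addCases with
      | left i => rw [Fin.append_left]; exact (hA' i).1
      | right i => rw [Fin.append_right]; exact (hB' i).1
    · intro hF
      by_cases h : u ⊆ F
      · obtain ⟨i, rfl⟩ : F ∈ Set.range B := hB ▸ mem_facets_star.2 ⟨hF, h⟩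
        exact ⟨Fin.natAdd a i, Fin.append_right A B i⟩
      · have hxF : x ∈ F := hF.le_of_ge (hadd F hF.prop h) (Finset.subset_insert x F)
          (Finset.mem_insert_self x F)
        obtain ⟨i, rfl⟩ : F ∈ Set.range A :=
          hA ▸ mem_facets_star.2 ⟨hF, Finset.singleton_subset_iff.2 hxF⟩
        exact ⟨Fin.castAdd b i, Fin.append_left A B i⟩
  · intro k
    induction k using Fin.addCases with
    | left k =>
      intro i
      induction i using Fin.addCases with
      | left i =>
        intro hik
        obtain ⟨v, hv, hvi, j, hj, hvj⟩ := hAs k i hik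
        exact ⟨v, by simpa using hv, by simpa using hvi, Fin.castAdd b j, hj, by simpa using hvj⟩
      | right i =>
        intro hik
        have := Fin.lt_def.1 hik
        simp only [Fin.val_natAdd, Fin.val_castAdd] at this
        omega
    | right k =>
      intro i
      induction i using Fin.addCases with
      | left i =>
        intro _
        -- A facet of the star of `x` misses some `v ∈ u`; then `x` can be added to `B k \ {v}`.
        obtain ⟨v, hvu, hvi⟩ := Finset.not_subset.1 (hAu i)
        have h1 : insert x ((B k).erase v) ∈ Δ :=
          hadd _ (Δ.lower (Finset.erase_subset v _) (hB' k).1.prop)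
            fun h => Finset.notMem_erase v _ (h hvu)
        have h2 : (B k).erase v ∈ Δ.star {x} := by
          rw [mem_star, Finset.union_comm, ← Finset.insert_eq]; exact h1
        obtain ⟨G, hG, hvG⟩ := exists_facet_of_mem h2
        obtain ⟨j, rfl⟩ : G ∈ Set.range A := hA ▸ hG
        refine ⟨v, by simpa using (hB' k).2 hvu, by simpa using hvi, Fin.castAdd b j, ?_,
          by simpa using hvG⟩
        rw [Fin.lt_def, Fin.val_castAdd, Fin.val_natAdd]
        omega
      | right i =>
        intro hik
        obtain ⟨v, hv, hvi, j, hj, hvj⟩ := hBs k i ((Fin.natAdd_lt_natAdd_iff a).1 hik)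
        exact ⟨v, by simpa using hv, by simpa using hvi, Fin.natAdd a j,
          (Fin.natAdd_lt_natAdd_iff a).2 hj, by simpa using hvj⟩

/-! ### Minors of complexes -/

/-- The minor of `Δ` in which the vertices in `X₁` are deleted and those in `X₂` are contracted.
It is kept on the vertex set `V`: no vertex in `X₁` is a vertex of it, and it is a cone over every
vertex in `X₂`. -/
def minor [DecidableEq V] (Δ : FaceComplex V) (X₁ X₂ : Finset V) : FaceComplex V where
  carrier := {F | Disjoint F X₁ ∧ F ∪ X₂ ∈ Δ}
  lower' := fun _ _ h hF =>
    ⟨hF.1.mono_left h, Δ.lower (Finset.union_subset_union_left h) hF.2⟩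

theorem mem_minor [DecidableEq V] {Δ : FaceComplex V} {X₁ X₂ F : Finset V} :
    F ∈ Δ.minor X₁ X₂ ↔ Disjoint F X₁ ∧ F ∪ X₂ ∈ Δ := Iff.rfl

theorem isShellable_of_facets_eq_singleton {Δ : FaceComplex V} {F : Finset V}
    (h : Δ.facets = {F}) : Δ.IsShellable := by
  refine ⟨1, fun _ => F, fun i j _ => Subsingleton.elim i j, by rw [Set.range_const, h], ?_⟩
  rintro k G hG
  obtain ⟨-, i, hi, -⟩ := hG.prop
  exact absurd hi (by rw [Subsingleton.elim i k]; exact lt_irrefl k)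

theorem isShellable_of_facets_eq_empty {Δ : FaceComplex V} (h : Δ.facets = ∅) :
    Δ.IsShellable :=
  ⟨0, Fin.elim0, fun i => i.elim0, by rw [h, Set.range_eq_empty], fun k => k.elim0⟩

/-- The combinatorial content of the free variable property: every minor of `Δ` which is neither
void nor a simplex on the remaining vertices has a nonface `insert x u` such that faces not containing
`u` may be enlarged by `x`. -/
def HasFreeMinors [Fintype V] [DecidableEq V] (Δ : FaceComplex V) : Prop :=
  ∀ X₁ X₂ : Finset V, Disjoint X₁ X₂ → X₂ ∈ Δ → X₁ᶜ ∉ Δ →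
    ∃ (x : V) (u : Finset V), x ∉ X₁ ∧ x ∉ X₂ ∧ x ∉ u ∧ Disjoint u X₁ ∧
      insert x u ∉ Δ.minor X₁ X₂ ∧
      ∀ F ∈ Δ.minor X₁ X₂, ¬ u ⊆ F → insert x F ∈ Δ.minor X₁ X₂

theorem HasFreeMinors.isShellable_minor [Fintype V] [DecidableEq V] {Δ : FaceComplex V}
    (h : Δ.HasFreeMinors) (X₁ X₂ : Finset V) (hX : Disjoint X₁ X₂) :
    (Δ.minor X₁ X₂).IsShellable := by
  by_cases h₂ : X₂ ∈ Δ
  swap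
  · refine isShellable_of_facets_eq_empty (Set.eq_empty_of_forall_notMem fun F hF => h₂ ?_)
    exact Δ.lower Finset.subset_union_right hF.prop.2
  by_cases h₁ : X₁ᶜ ∈ Δ
  · refine isShellable_of_facets_eq_singleton (F := X₁ᶜ) ?_
    have hmem : X₁ᶜ ∈ Δ.minor X₁ X₂ := by
      refine ⟨disjoint_compl_left, ?_⟩
      rwa [Finset.union_eq_left.2 (Finset.subset_compl_iff_disjoint_left.2 hX)]
    have hle : ∀ F ∈ Δ.minor X₁ X₂, F ⊆ X₁ᶜ := fun F hF =>
      Finset.subset_compl_iff_disjoint_right.2 hF.1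
    ext F
    exact ⟨fun hF => hF.eq_of_le hmem (hle F hF.prop),
      fun hF => hF ▸ ⟨hmem, fun G hG _ => hle G hG⟩⟩
  obtain ⟨x, u, hx₁, hx₂, hxu, hu₁, hnon, hadd⟩ := h X₁ X₂ hX h₂ h₁
  refine isShellable_of_star hnon hadd ?_ ?_
  · have : (Δ.minor X₁ X₂).star {x} = Δ.minor X₁ (insert x X₂) := by
      ext F
      change (Disjoint (F ∪ {x}) X₁ ∧ F ∪ {x} ∪ X₂ ∈ Δ) ↔ (Disjoint F X₁ ∧ F ∪ insert x X₂ ∈ Δ)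
      rw [Finset.union_assoc, ← Finset.insert_eq, Finset.disjoint_union_left,
        Finset.disjoint_singleton_left]
      tauto
    rw [this]
    exact HasFreeMinors.isShellable_minor h X₁ (insert x X₂)
      (Finset.disjoint_insert_right.2 ⟨hx₁, hX⟩)
  · have : (Δ.minor X₁ X₂).star u = Δ.minor (insert x X₁) (X₂ ∪ u) := by
      ext F
      change (Disjoint (F ∪ u) X₁ ∧ F ∪ u ∪ X₂ ∈ Δ) ↔
        (Disjoint F (insert x X₁) ∧ F ∪ (X₂ ∪ u) ∈ Δ)
      rw [Finset.union_assoc, Finset.union_comm u, Finset.disjoint_union_left,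
        Finset.disjoint_insert_right]
      refine ⟨fun ⟨⟨h1, _⟩, h2⟩ => ⟨⟨fun hxF => hnon ⟨?_, ?_⟩, h1⟩, h2⟩,
        fun ⟨⟨_, h1⟩, h2⟩ => ⟨⟨h1, hu₁⟩, h2⟩⟩
      · exact Finset.disjoint_insert_left.2 ⟨hx₁, hu₁⟩
      · refine Δ.lower ?_ h2
        intro w hw
        simp only [Finset.mem_union, Finset.mem_insert] at hw ⊢
        rcases hw with (rfl | hw) | hw <;> tauto
    rw [this]
    refine HasFreeMinors.isShellable_minor h (insert x X₁) (X₂ ∪ u) ?_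
    exact Finset.disjoint_union_right.2 ⟨Finset.disjoint_insert_left.2 ⟨hx₂, hX⟩,
      Finset.disjoint_insert_left.2 ⟨hxu, hu₁.symm⟩⟩
termination_by (X₁ ∪ X₂)ᶜ.card
decreasing_by
  all_goals
    refine Finset.card_lt_card (Finset.compl_ssubset_compl.2 ?_)
    refine (Finset.ssubset_iff_of_subset ?_).2 ⟨x, by simp, by simp [hx₁, hx₂]⟩
    intro w hw
    simp only [Finset.mem_union, Finset.mem_insert] at hw ⊢
    tauto

theorem HasFreeMinors.isShellable [Fintype V] [DecidableEq V] {Δ : FaceComplex V}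
    (h : Δ.HasFreeMinors) : Δ.IsShellable := by
  have : Δ.minor ∅ ∅ = Δ := by
    ext F
    change (Disjoint F ∅ ∧ F ∪ ∅ ∈ Δ) ↔ F ∈ Δ
    simp
  exact this ▸ h.isShellable_minor ∅ ∅ (Finset.disjoint_empty_left ∅)

end FaceComplex

open MvPolynomial

/-! ### Prime ideals generated by variables -/

theorem MvPolynomial.isPrime_span_X_image {σ K : Type*} [Field K] (A : Set σ) :
    (Ideal.span (X '' A) : Ideal (MvPolynomial σ K)).IsPrime := by
  classical
  let φ : MvPolynomial σ K →ₐ[K] MvPolynomial σ K := aeval fun i => if i ∈ A then 0 else X i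
  let q := Ideal.Quotient.mkₐ K (Ideal.span (X '' A) : Ideal (MvPolynomial σ K))
  have hq : q.comp φ = q := by
    ext i
    by_cases hi : i ∈ A
    · have h0 : q (X i) = 0 := Ideal.Quotient.eq_zero_iff_mem.2 (Ideal.subset_span ⟨i, hi, rfl⟩)
      simp [φ, hi, h0]
    · simp [φ, hi]
  have hker : Ideal.span (X '' A) = RingHom.ker φ := by
    refine le_antisymm (Ideal.span_le.2 ?_) fun f hf => ?_
    · rintro _ ⟨i, hi, rfl⟩
      simp [φ, hi]
    · have h : q f = 0 := by
        rw [← hq, AlgHom.comp_apply, (RingHom.mem_ker).1 hf, map_zero]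
      exact Ideal.Quotient.eq_zero_iff_mem.1 h
  rw [hker]
  exact RingHom.ker_isPrime φ

theorem MvPolynomial.X_mem_span_X_image {σ K : Type*} [Field K] {A : Set σ} {i : σ} :
    (X i : MvPolynomial σ K) ∈ Ideal.span (X '' A) ↔ i ∈ A := by
  classical
  refine ⟨fun h => ?_, fun h => Ideal.subset_span ⟨i, h, rfl⟩⟩
  obtain ⟨j, hj, hji⟩ := mem_ideal_span_X_image.1 h (Finsupp.single i 1) (by simp [support_X])
  rw [Finsupp.single_apply_ne_zero] at hji
  exact hji.1 ▸ hj

theorem MvPolynomial.prod_X_mem_span_X_image {σ K : Type*} [Field K] {A : Set σ} {s : Finset σ} :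
    (∏ i ∈ s, X i : MvPolynomial σ K) ∈ Ideal.span (X '' A) ↔ ∃ i ∈ s, i ∈ A := by
  simp only [(isPrime_span_X_image A).prod_mem_iff, X_mem_span_X_image]

/-- If `J' = J + (g)` and `J : g = P`, multiplication by `g` induces `R/P ≅ J'/J`. -/
theorem Ideal.nonempty_quotient_submoduleOf_equiv {R : Type*} [CommRing R] {J J' P : Ideal R} {g : R}
    (hJ : J' = J ⊔ Ideal.span {g}) (hP : ∀ f, f * g ∈ J ↔ f ∈ P) :
    Nonempty ((↥J' ⧸ J.submoduleOf J') ≃ₗ[R] (R ⧸ P)) := by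
  have hg : g ∈ J' := hJ ▸ Ideal.mem_sup_right (Ideal.mem_span_singleton_self g)
  let φ : R →ₗ[R] (↥J' ⧸ J.submoduleOf J') :=
    (J.submoduleOf J').mkQ ∘ₗ LinearMap.toSpanSingleton R J' ⟨g, hg⟩
  have hker : LinearMap.ker φ = P := by
    ext f
    rw [← hP, LinearMap.mem_ker, LinearMap.comp_apply, Submodule.mkQ_apply,
      Submodule.Quotient.mk_eq_zero]
    rfl
  have hsurj : Function.Surjective φ := by
    intro y
    obtain ⟨⟨y, hy⟩, rfl⟩ := Submodule.mkQ_surjective _ y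
    have hy' := hy
    rw [hJ] at hy'
    obtain ⟨a, ha, b, hb, rfl⟩ := Submodule.mem_sup.1 hy'
    obtain ⟨c, rfl⟩ := Ideal.mem_span_singleton'.1 hb
    refine ⟨c, ?_⟩
    rw [LinearMap.comp_apply, Submodule.mkQ_apply, Submodule.mkQ_apply, Submodule.Quotient.eq]
    change c * g - (a + c * g) ∈ J
    rw [sub_add_cancel_right]
    exact J.neg_mem ha
  exact ⟨((Submodule.quotEquivOfEq _ _ hker.symm).trans
    (φ.quotKerEquivOfSurjective hsurj)).symm⟩

namespace FaceComplex

variable {V : Type*} (K : Type*) [Field K]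

/-! ### Shellable complexes have clean Stanley–Reisner rings -/

/-- The prime ideal `P_F`, generated by the variables outside `F`. -/
noncomputable def facePrime (F : Finset V) : Ideal (MvPolynomial V K) :=
  Ideal.span (X '' {i | i ∉ F})

variable {K}

theorem stanleyReisnerIdeal_le_facePrime {Δ : FaceComplex V} {F : Finset V} (hF : F ∈ Δ) :
    Δ.stanleyReisnerIdeal K ≤ facePrime K F := by
  refine Ideal.span_le.2 ?_
  rintro _ ⟨G, hG, rfl⟩
  exact prod_X_mem_span_X_image.2 (Finset.not_subset.1 fun h => hG (Δ.lower h hF))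

theorem facePrime_mem_minimalPrimes {Δ : FaceComplex V} {F : Finset V} (hF : F ∈ Δ.facets) :
    facePrime K F ∈ (Δ.stanleyReisnerIdeal K).minimalPrimes := by
  classical
  refine ⟨⟨isPrime_span_X_image _, stanleyReisnerIdeal_le_facePrime hF.prop⟩, ?_⟩
  rintro Q ⟨hQ, hIQ⟩ hQF
  refine Ideal.span_le.2 ?_
  rintro _ ⟨v, hv, rfl⟩
  have hmem : (∏ i ∈ insert v F, X i : MvPolynomial V K) ∈ Q := by
    refine hIQ (Ideal.subset_span ⟨_, fun h => hv ?_, rfl⟩)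
    exact hF.le_of_ge h (Finset.subset_insert v F) (Finset.mem_insert_self v F)
  obtain ⟨w, hw, hwQ⟩ := hQ.prod_mem_iff.1 hmem
  have hwF : w ∉ F := X_mem_span_X_image.1 (hQF hwQ)
  obtain rfl := Finset.mem_insert.1 hw |>.resolve_right hwF
  exact hwQ

/-- The complex generated by the first `k` sets of a list. -/
def initialComplex {m : ℕ} (F : Fin m → Finset V) (k : ℕ) : FaceComplex V where
  carrier := {G | ∃ i : Fin m, i.val < k ∧ G ⊆ F i}
  lower' := fun _ _ h ⟨i, hi, hG⟩ => ⟨i, hi, h.trans hG⟩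

theorem stanleyReisnerIdeal_anti {Δ Γ : FaceComplex V} (h : Δ ≤ Γ) :
    Γ.stanleyReisnerIdeal K ≤ Δ.stanleyReisnerIdeal K :=
  Ideal.span_mono (Set.image_mono fun _ hG hG' => hG (h hG'))

/-- The step of Dress's filtration that removes the facet `F k`. With `R` the set of all `v ∈ F k`
such that the ridge `F k \ {v}` lies in an earlier facet, the faces of `F k` that are new are exactly
those containing `R`, so the larger ideal arises by adjoining `x_R`, and the colon ideal is
`P_{F k}`. -/
theorem nonempty_equiv_of_isShellingOrder [DecidableEq V] {m : ℕ} {F : Fin m → Finset V}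
    (hF : IsShellingOrder F) (k : Fin m) {a b : ℕ} (ha : a = k.val) (hb : b = k.val + 1) :
    Nonempty
      ((↥((initialComplex F a).stanleyReisnerIdeal K) ⧸
        ((initialComplex F b).stanleyReisnerIdeal K).submoduleOf
          ((initialComplex F a).stanleyReisnerIdeal K))
        ≃ₗ[MvPolynomial V K] (MvPolynomial V K ⧸ facePrime K (F k))) := by
  classical
  subst ha hb
  let R := (F k).filter fun v => (F k).erase v ∈ initialComplex F k.val
  have hRk : R ⊆ F k := Finset.filter_subset _ _
  have hR : ∀ i < k, ¬ R ⊆ F i := fun i hi h => by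
    obtain ⟨v, hv, hvi, j, hj, hvj⟩ := hF k i hi
    exact hvi (h (Finset.mem_filter.2 ⟨hv, j, hj, hvj⟩))
  have hRmem : R ∉ initialComplex F k.val := fun ⟨i, hi, h⟩ => hR i hi h
  have hk : F k ∈ initialComplex F (k.val + 1) := ⟨k, Nat.lt_succ_self _, subset_rfl⟩
  refine Ideal.nonempty_quotient_submoduleOf_equiv (g := ∏ i ∈ R, X i)
    (le_antisymm (Ideal.span_le.2 ?_) (sup_le ?_ ?_)) fun f => ⟨fun hf => ?_, fun hf => ?_⟩
  · rintro _ ⟨G, hG, rfl⟩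
    by_cases hG' : G ∈ initialComplex F (k.val + 1)
    · obtain ⟨i, hi, hGi⟩ := hG'
      have hik : i = k := by
        by_contra hne
        have := Fin.val_ne_of_ne hne
        exact hG ⟨i, by omega, hGi⟩
      subst hik
      have hRG : R ⊆ G := by
        intro v hv
        by_contra hvG
        refine hG ((initialComplex F _).lower ?_ (Finset.mem_filter.1 hv).2)
        exact fun w hw => Finset.mem_erase.2 ⟨fun h => hvG (h ▸ hw), hGi hw⟩
      exact Ideal.mem_sup_right (Ideal.mem_span_singleton.2
        (Finset.prod_dvd_prod_of_subset R G _ hRG))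
    · exact Ideal.mem_sup_left (Ideal.subset_span ⟨G, hG', rfl⟩)
  · exact stanleyReisnerIdeal_anti fun G ⟨i, hi, h⟩ => ⟨i, Nat.lt_succ_of_lt hi, h⟩
  · exact (Ideal.span_singleton_le_iff_mem _).2 (Ideal.subset_span ⟨R, hRmem, rfl⟩)
  · refine ((isPrime_span_X_image _).mem_or_mem
      (stanleyReisnerIdeal_le_facePrime hk hf)).resolve_right fun h => ?_
    obtain ⟨i, hi, hik⟩ := prod_X_mem_span_X_image.1 h
    exact hik (hRk hi)
  · have hle : facePrime K (F k) ≤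
        ((initialComplex F (k.val + 1)).stanleyReisnerIdeal K).colon {∏ i ∈ R, X i} := by
      refine Ideal.span_le.2 ?_
      rintro _ ⟨v, hv, rfl⟩
      rw [SetLike.mem_coe, Submodule.mem_colon_singleton, smul_eq_mul,
        ← Finset.prod_insert fun h => hv (hRk h)]
      refine Ideal.subset_span ⟨_, ?_, rfl⟩
      rintro ⟨i, hi, h⟩
      have hvi := h (Finset.mem_insert_self v R)
      rcases (Nat.lt_succ_iff.1 hi).lt_or_eq with hlt | heq
      · exact hR i hlt ((Finset.subset_insert v R).trans h)
      · obtain rfl : i = k := Fin.ext heq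
        exact hv hvi
    exact Submodule.mem_colon_singleton.1 (hle hf)

/-- Dress's theorem: the filtration of a shelling from its last facet to its first is a clean one. -/
theorem IsShellable.isClean [Finite V] {Δ : FaceComplex V} (h : Δ.IsShellable) :
    IsClean (Δ.stanleyReisnerIdeal K) := by
  classical
  obtain ⟨m, F, -, hFΔ, hF⟩ := Δ.isShellable_iff.1 h
  have hfacet : ∀ i, F i ∈ Δ.facets := fun i => hFΔ ▸ Set.mem_range_self i
  have hΔ : initialComplex F m = Δ := by
    ext G
    refine ⟨fun ⟨i, _, hGi⟩ => Δ.lower hGi (hfacet i).prop, fun hG => ?_⟩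
    obtain ⟨_, hH, hGH⟩ := exists_facet_of_mem hG
    rw [← hFΔ] at hH
    obtain ⟨i, rfl⟩ := hH
    exact ⟨i, i.isLt, hGH⟩
  refine ⟨m, fun j => (initialComplex F (m - j.val)).stanleyReisnerIdeal K,
    fun j => facePrime K (F j.rev), ?_, ?_, fun j => ⟨?_, ⟨_, rfl⟩,
      facePrime_mem_minimalPrimes (hfacet j.rev), ?_⟩⟩
  · exact congrArg _ hΔ
  · -- The complex generated by no set at all is void, so its ideal contains the empty product.
    rw [Ideal.eq_top_iff_one]
    refine Ideal.subset_span ⟨∅, fun ⟨i, hi, _⟩ => ?_, Finset.prod_empty⟩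
    simp at hi
  · refine stanleyReisnerIdeal_anti fun G ⟨i, hi, hG⟩ => ⟨i, hi.trans_le ?_, hG⟩
    simp only [Fin.val_succ, Fin.val_castSucc]
    omega
  · have ha : m - j.succ.val = j.rev.val := by rw [Fin.val_rev, Fin.val_succ]
    have hb : m - j.castSucc.val = j.rev.val + 1 := by
      rw [Fin.val_rev, Fin.val_castSucc]
      omega
    exact nonempty_equiv_of_isShellingOrder hF j.rev ha hb

end FaceComplex


/-! ### Minors of Stanley–Reisner ideals -/

section minorMap

variable {V K : Type*} [Field K] {X₁ X₂ : Set V}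

theorem minorMap_X_of_mem_left {i : V} (h : i ∈ X₁) : minorMap K X₁ X₂ (X i) = 0 := by
  simp [minorMap, h]

theorem minorMap_X_of_mem_right {i : V} (h₁ : i ∉ X₁) (h : i ∈ X₂) :
    minorMap K X₁ X₂ (X i) = 1 := by
  simp [minorMap, h₁, h]

theorem minorMap_X_coe (i : {i : V // i ∉ X₁ ∧ i ∉ X₂}) :
    minorMap K X₁ X₂ (X i.1) = X i := by
  simp [minorMap, i.2.1, i.2.2]

end minorMap

theorem MvPolynomial.prod_X_dvd_monomial {σ K : Type*} [Field K] (w : σ →₀ ℕ) :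
    (∏ i ∈ w.support, X i : MvPolynomial σ K) ∣ monomial w 1 := by
  rw [monomial_eq, C_1, one_mul]
  exact Finset.prod_dvd_prod_of_dvd _ _ fun i hi =>
    dvd_pow_self _ (Finsupp.mem_support_iff.1 hi)

namespace FaceComplex

variable {V K : Type*} [Field K] [DecidableEq V] {Δ : FaceComplex V} {X₁ X₂ : Finset V}

/-- A monomial lies in the minor of a Stanley–Reisner ideal exactly if its support is a nonface of
the corresponding minor of the complex. -/
theorem monomial_mem_minor_iff (hX : Disjoint X₁ X₂)
    (w : {i : V // i ∉ (X₁ : Set V) ∧ i ∉ (X₂ : Set V)} →₀ ℕ) :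
    monomial w (1 : K) ∈ (Δ.stanleyReisnerIdeal K).minor X₁ X₂ ↔
      w.support.map (Function.Embedding.subtype _) ∪ X₂ ∉ Δ := by
  classical
  constructor
  · intro h hΔ
    -- Evaluating at the indicator vector of the support kills the minor, but not `x ^ w`.
    let ψ : MvPolynomial {i : V // i ∉ (X₁ : Set V) ∧ i ∉ (X₂ : Set V)} K →ₐ[K] K :=
      aeval fun i => if i ∈ w.support then 1 else 0
    have hle : (Δ.stanleyReisnerIdeal K).minor X₁ X₂ ≤ RingHom.ker ψ := by
      refine Ideal.map_le_iff_le_comap.2 (Ideal.span_le.2 ?_)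
      rintro _ ⟨F, hF, rfl⟩
      obtain ⟨i, hiF, hi⟩ := Finset.not_subset.1 fun h => hF (Δ.lower h hΔ)
      rw [Finset.mem_union, not_or] at hi
      simp only [SetLike.mem_coe, Ideal.mem_comap, RingHom.mem_ker, map_prod]
      refine Finset.prod_eq_zero hiF ?_
      by_cases hi₁ : i ∈ X₁
      · rw [minorMap_X_of_mem_left (Finset.mem_coe.2 hi₁), map_zero]
      · have hiw : (⟨i, hi₁, hi.2⟩ : {i : V // i ∉ (X₁ : Set V) ∧ i ∉ (X₂ : Set V)}) ∉
            w.support := fun hw => hi.1 (Finset.mem_map.2 ⟨_, hw, rfl⟩)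
        rw [minorMap_X_coe ⟨i, hi₁, hi.2⟩, aeval_X, if_neg hiw]
    have h0 : ψ (monomial w 1) = 0 := hle h
    have h1 : ψ (monomial w 1) = 1 := by
      rw [aeval_monomial, map_one, one_mul, Finsupp.prod]
      exact Finset.prod_eq_one fun i hi => by rw [if_pos hi, one_pow]
    exact one_ne_zero (h1.symm.trans h0)
  · intro h
    have hmem := Ideal.mem_map_of_mem (minorMap K (X₁ : Set V) X₂)
      ((prod_X_mem_stanleyReisnerIdeal K Δ _).2 h)
    have hdisj : Disjoint (w.support.map (Function.Embedding.subtype _)) X₂ := by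
      rw [Finset.disjoint_left]
      intro i hi
      obtain ⟨j, -, rfl⟩ := Finset.mem_map.1 hi
      exact j.2.2
    have h2 : ∏ i ∈ X₂, minorMap K (X₁ : Set V) X₂ (X i) = 1 :=
      Finset.prod_eq_one fun i hi => minorMap_X_of_mem_right
        (Finset.disjoint_right.1 hX hi) hi
    rw [map_prod, Finset.prod_union hdisj, h2, mul_one, Finset.prod_map] at hmem
    simp only [Function.Embedding.subtype_apply, minorMap_X_coe] at hmem
    exact Ideal.mem_of_dvd _ (prod_X_dvd_monomial w) hmem

/-- A free variable `x_i` of a minor, dividing the single minimal generator `x_e`, yields the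
splitting with `x = i` and `u = e \ {i}`. -/
theorem hasFreeMinors_of_hasFreeVariableProperty [Fintype V]
    (h : HasFreeVariableProperty (Δ.stanleyReisnerIdeal K)) : Δ.HasFreeMinors := by
  intro X₁ X₂ hX hX₂ hX₁
  have hmem := monomial_mem_minor_iff (K := K) (Δ := Δ) hX
  have hbot : (Δ.stanleyReisnerIdeal K).minor X₁ X₂ ≠ ⊥ := by
    -- The product of all remaining variables lies in the minor, as the complement of `X₁` is a
    -- nonface.
    intro hbot
    let z := Finsupp.indicator
      (Finset.univ : Finset {i : V // i ∉ (X₁ : Set V) ∧ i ∉ (X₂ : Set V)}) fun _ _ => (1 : ℕ)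
    have hz : monomial z (1 : K) ∈ (Δ.stanleyReisnerIdeal K).minor X₁ X₂ := by
      refine (hmem z).2 fun hface => hX₁ (Δ.lower ?_ hface)
      intro j hj
      by_cases hj₂ : j ∈ X₂
      · exact Finset.mem_union_right _ hj₂
      · refine Finset.mem_union_left _ (Finset.mem_map.2
          ⟨⟨j, Finset.mem_compl.1 hj, hj₂⟩, ?_, rfl⟩)
        simp [z]
    rw [hbot, Ideal.mem_bot, monomial_eq_zero] at hz
    exact one_ne_zero hz
  have htop : (Δ.stanleyReisnerIdeal K).minor X₁ X₂ ≠ ⊤ := by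
    intro htop
    refine (hmem 0).1 (htop ▸ Submodule.mem_top) ?_
    simpa using hX₂
  obtain ⟨i, w, hw, hwi, huniq⟩ := h X₁ X₂ (Finset.disjoint_coe.2 hX) hbot htop
  let ι := Function.Embedding.subtype fun i : V => i ∉ (X₁ : Set V) ∧ i ∉ (X₂ : Set V)
  have hdisj : ∀ s : Finset _, Disjoint (s.map ι) X₁ := fun s => by
    rw [Finset.disjoint_left]
    intro j hj
    obtain ⟨k, -, rfl⟩ := Finset.mem_map.1 hj
    exact k.2.1
  refine ⟨i.1, (w.support.erase i).map ι, i.2.1, i.2.2, fun hi => ?_, hdisj _, ?_, ?_⟩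
  · obtain ⟨j, hj, hji⟩ := Finset.mem_map.1 hi
    exact Finset.ne_of_mem_erase hj (Subtype.ext hji)
  · have : insert i.1 ((w.support.erase i).map ι) = w.support.map ι := by
      rw [← Finset.insert_erase (Finsupp.mem_support_iff.2 hwi), Finset.map_insert,
        Finset.erase_insert_eq_erase, Finset.erase_idem]
      rfl
    rw [this]
    exact fun hface => (hmem w).1 hw.1 hface.2
  · intro F hF hwF
    refine ⟨Finset.disjoint_insert_left.2 ⟨i.2.1, hF.1⟩, ?_⟩
    by_contra hnon
    -- The squarefree monomial on `insert i F` lies in the minor, hence so does a minimal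
    -- generator `v` dividing it.
    let s : Finset {i : V // i ∉ (X₁ : Set V) ∧ i ∉ (X₂ : Set V)} :=
      Finset.univ.filter fun j => j.1 ∈ insert i.1 F
    let z := Finsupp.indicator s fun _ _ => (1 : ℕ)
    have hzs : z.support = s := by
      ext j
      simp [z, Finsupp.indicator_apply]
    have hz : monomial z (1 : K) ∈ (Δ.stanleyReisnerIdeal K).minor X₁ X₂ := by
      refine (hmem z).2 fun hface => hnon (Δ.lower ?_ hface)
      rw [hzs]
      intro j hj
      by_cases hj₂ : j ∈ X₂
      · exact Finset.mem_union_right _ hj₂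
      · have hjF := (Finset.mem_union.1 hj).resolve_right hj₂
        have hj₁ : j ∉ X₁ := by
          rcases Finset.mem_insert.1 hjF with rfl | hjF
          exacts [i.2.1, Finset.disjoint_left.1 hF.1 hjF]
        exact Finset.mem_union_left _ (Finset.mem_map.2
          ⟨⟨j, hj₁, hj₂⟩, Finset.mem_filter.2 ⟨Finset.mem_univ _, hjF⟩, rfl⟩)
    obtain ⟨v, hvz, hv⟩ := exists_minimal_le_of_wellFoundedLT
      (fun v => monomial v (1 : K) ∈ (Δ.stanleyReisnerIdeal K).minor X₁ X₂) z hz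
    have hvs : ∀ j ∈ v.support, j.1 = i.1 ∨ j.1 ∈ F := fun j hj => by
      have hjs : j ∈ z.support := Finsupp.support_mono hvz hj
      rw [hzs] at hjs
      exact Finset.mem_insert.1 (Finset.mem_filter.1 hjs).2
    by_cases hvw : v = w
    · refine hwF fun j hj => ?_
      obtain ⟨k, hk, rfl⟩ := Finset.mem_map.1 hj
      have hk' := Finset.mem_erase.1 hk
      exact (hvs k (hvw ▸ hk'.2)).resolve_left fun h => hk'.1 (Subtype.ext h)
    · have hvi := huniq v hv hvw
      refine (hmem v).1 hv.prop (Δ.lower (Finset.union_subset_union_left ?_) hF.2)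
      intro j hj
      obtain ⟨k, hk, rfl⟩ := Finset.mem_map.1 hj
      refine (hvs k hk).resolve_left fun h => ?_
      rw [Subtype.ext h] at hk
      exact Finsupp.mem_support_iff.1 hk hvi

end FaceComplex

theorem corollary3p9 {n : ℕ} (K : Type*) [Field K] (C : Clutter (Fin n))
    (hC : C.HasFreeVertexProperty K) :
    IsClean (C.edgeIdeal K) ∧ C.stanleyReisnerComplex.IsShellable := by
  rw [Clutter.HasFreeVertexProperty, ← C.stanleyReisnerIdeal_stanleyReisnerComplex K] at hC
  have h := (FaceComplex.hasFreeMinors_of_hasFreeVariableProperty hC).isShellable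
  exact ⟨C.stanleyReisnerIdeal_stanleyReisnerComplex K ▸ h.isClean, h⟩
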